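/- Let $q$ be a power of a prime, let $k>2$ be an even integer, let $\alpha$ be a primitive element of $\mathbb F_{q^k}$, and let $\mathrm{Tr}_{q^k/q}$ and $\mathrm{Tr}_{q^2/q}$ denote the traces from $\mathbb F_{q^k}$ and from $\mathbb F_{q^2}$ to $\mathbb F_q$. Let $$D=\{x\in\mathbb F_{q^k}^*:\ \mathrm{Tr}_{q^2/q}(x^{\frac{q^k-1}{q^2-1}})=0\}=\{d_1,\dots,d_n\}$$ with the elements listed in any order, and let $$\mathcal C_D=\{(\mathrm{Tr}_{q^k/q}(xd_1),\dots,\mathrm{Tr}_{q^k/q}(xd_n)):\ x\in\mathbb F_{q^k}\}\subseteq\mathbb F_q^n.$$ Let $$\mathcal C=\{(\mathrm{Tr}_{q^k/q}(x\alpha^{(q+1)i}))_{0\le i<\frac{q^k-1}{q+1}}:\ x\in\mathbb F_{q^k}\}.$$ Then $\mathcal C$ is an irreducible cyclic code (that is, it is nonzero, stable under the cyclic shift, and has no shift-stable subspaces other than $0$ and itself), and $\mathcal C_D$ is equivalent to $\mathcal C$ by a permutation of the coordinates. Furthermore, the following hold. Here an $[n,l,d]$ code is an $l$-dimensional subspace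 of $\mathbb F_q^n$ of minimum Hamming distance $d$, its weight enumerator is $1+\sum_{i=1}^n A_iz^i$, where $A_i$ is the number of codewords of Hamming weight $i$, and it is a two-weight code if exactly two of $A_1,\dots,A_n$ are nonzero. If $k\equiv0\pmod 4$, then $\mathcal C_D$ is a $\left[\frac{q^k-1}{q+1},\,k,\,\frac{(q-1)(q^{k-1}-q^{\frac k2-1})}{q+1}\right]$ two-weight code with weight enumerator $$1+\frac{q(q^k-1)}{q+1}z^{\frac{(q-1)(q^{k-1}-q^{\frac k2-1})}{q+1}}+\frac{q^k-1}{q+1}z^{\frac{(q-1)(q^{k-1}+q^{\frac k2})}{q+1}}.$$ If $k\equiv2\pmod 4$, then $\mathcal C_D$ is a $\left[\frac{q^k-1}{q+1},\,k,\,\frac{(q-1)(q^{k-1}-q^{\frac k2})}{q+1}\right]$ two-weight code with weight enumerator $$1+\frac{q^k-1}{q+1}z^{\frac{(q-1)(q^{k-1}-q^{\frac k2})}{q+1}}+\frac{q(q^k-1)}{q+1}z^{\frac{(q-1)(q^{k-1}+q^{\frac k2-1})}{q+1}}.$$ -/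

import Mathlib

namespace LinCode

/-- The code `{(Tr_{K/F}(x d₁), …, Tr_{K/F}(x dₙ)) : x ∈ K}` of length `n` over `F`. -/
noncomputable def traceCode (F : Type*) {K : Type*} [Field F] [Field K] [Algebra F K]
    {n : ℕ} (d : Fin n → K) : Submodule F (Fin n → F) :=
  LinearMap.range
    (LinearMap.pi fun i => (Algebra.trace F K).comp (LinearMap.mulRight F (d i)))

theorem mem_traceCode {F K : Type*} [Field F] [Field K] [Algebra F K]
    {n : ℕ} (d : Fin n → K) (c : Fin n → F) :
    c ∈ traceCode F d ↔ ∃ x : K, (fun i => Algebra.trace F K (x * d i)) = c :=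
  Iff.rfl

/-- For finite fields `F ⊆ E ⊆ K` and `a ∈ F`, the set of all nonzero `x ∈ K` with
`Tr_{E/F}(x ^ ((|K| - 1) / (|E| - 1))) + a = 0`. The power lies in the subfield `E` of `K`;
`y` is that power as an element of `E`. -/
def definingSet (F E K : Type*) [Field F] [Field E] [Field K] [Algebra F E] [Algebra E K]
    (a : F) : Set K :=
  {x | x ≠ 0 ∧ ∃ y : E, algebraMap E K y = x ^ ((Nat.card K - 1) / (Nat.card E - 1)) ∧
    Algebra.trace F E y + a = 0}

/-- Two codes are (permutation) equivalent if one is obtained from the other by permuting the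
coordinate positions. -/
def PermEquivalent {F : Type*} [Field F] {n m : ℕ}
    (C : Submodule F (Fin n → F)) (C' : Submodule F (Fin m → F)) : Prop :=
  ∃ e : Fin m ≃ Fin n, ∀ c : Fin n → F, c ∈ C ↔ c ∘ e ∈ C'

/-- A linear code is cyclic if it is stable under the cyclic shift of the coordinates. -/
def IsCyclicCode {F : Type*} [Field F] {n : ℕ} (C : Submodule F (Fin n → F)) : Prop :=
  ∀ c ∈ C, c ∘ finRotate n ∈ C

/-- A cyclic code is irreducible if it is nonzero and its only cyclic subcodes are `0` and
itself. -/
def IsIrreducibleCyclicCode {F : Type*} [Field F] {n : ℕ}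
    (C : Submodule F (Fin n → F)) : Prop :=
  IsCyclicCode C ∧ C ≠ ⊥ ∧ ∀ B : Submodule F (Fin n → F), B ≤ C → IsCyclicCode B → B = ⊥ ∨ B = C

/-- `C`, a linear code of length `n`, has dimension `l` and minimum Hamming distance `d`. -/
def HasParameters {F : Type*} [Field F] [DecidableEq F] {n : ℕ}
    (C : Submodule F (Fin n → F)) (l d : ℕ) : Prop :=
  Module.finrank F C = l ∧ IsLeast {t : ℕ | ∃ u ∈ C, ∃ v ∈ C, u ≠ v ∧ hammingDist u v = t} d

/-- `A_i`: the number of codewords of Hamming weight `i`. -/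
noncomputable def weightCount {F : Type*} [Field F] [DecidableEq F] {n : ℕ}
    (C : Submodule F (Fin n → F)) (i : ℕ) : ℕ :=
  Set.ncard {c : Fin n → F | c ∈ C ∧ hammingNorm c = i}

/-- The weight enumerator `1 + A₁ z + ⋯ + Aₙ zⁿ`. -/
noncomputable def weightEnumerator {F : Type*} [Field F] [DecidableEq F] {n : ℕ}
    (C : Submodule F (Fin n → F)) : Polynomial ℕ :=
  1 + ∑ i ∈ Finset.Icc 1 n, Polynomial.C (weightCount C i) * Polynomial.X ^ i

/-- `C` is a `t`-weight code: exactly `t` of the numbers `A₁, …, Aₙ` are nonzero. -/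
def IsWeightCode {F : Type*} [Field F] [DecidableEq F] {n : ℕ}
    (t : ℕ) (C : Submodule F (Fin n → F)) : Prop :=
  ((Finset.Icc 1 n).filter fun i => weightCount C i ≠ 0).card = t

end LinCode

/-!
Let `m = (q^k - 1)/(q + 1)` and `M = (q^k - 1)/(q^2 - 1)`. On `E`, the trace to `F` is `y + y^q`, so
`x` lies in the defining set exactly when `x^m = -1`. Such elements exist because
`(-1)^(q+1) = 1`, and they form a coset `c H` of the group `H` of `(q+1)`-th powers, generated by
`α^(q+1)` (`exists_equiv_definingSet`). Listing `c H` along the powers of `α^(q+1)` and absorbing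
`c` into `x` turns one code into the other. A cyclic subcode of the code on `H` pulls back to a
subspace of `K` stable under `F[α^(q+1)]`, which is all of `K` since `α^(q+1)` has too large an
order to lie in a proper subfield (`adjoin_pow_eq_top`); so the code is irreducible.

The weight of the codeword of `x` is governed by the number of zeros of the Hermitian form
`y ↦ Tr(a y^(q+1))` with `a = x c`, hence by the exponential sum `S(a) = ∑ ψ(Tr(a y^(q+1)))` over
`y ∈ K` (`normPowerSum`). Three facts determine it:

* Elements of `F` are `(q+1)`-th powers in `K`, so `S` is constant on nonzero `F`-multiples of `a`.
  This makes `S(a)` rational, an affine function of the number of zeros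
  (`normPowerSum_eq_card_zeros`), and congruent to `1` modulo `q + 1`, because zeros come in orbits
  under the nonzero elements of `E`.
* `S(a)^2 = S(a) S(-a)` is `q^k` times the size of the radical of the form
  (`normPowerSum_mul_normPowerSum_neg`), which is `1` or `q^2` (`card_radical`). With the congruence,
  which fixes the sign, `S(a)` is `(-q)^(k/2)`, or `(-q)^(k/2+1)` if the form is degenerate
  (`normPowerSum_eq_ite`).
* `∑ S(a) = q^k` over all `a ∈ K`, which gives the number of degenerate forms (`card_isDegenerate`).

The weight enumerator follows by a count (`hasParameters_and_weightEnumerator_of_two_weights`).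
-/

open Finset

/-! ### Exponential sums of `Tr(a y^(q+1))` -/

theorem add_pow_card {F K : Type*} [Field F] [Field K] [Fintype F] [Algebra F K]
    (x y : K) :
    (x + y) ^ Fintype.card F = x ^ Fintype.card F + y ^ Fintype.card F :=
  map_add (FiniteField.frobeniusAlgHom F K) x y

theorem algebraMap_pow_card {F K : Type*} [Field F] [Field K] [Fintype F] [Algebra F K]
    (c : F) :
    algebraMap F K c ^ Fintype.card F = algebraMap F K c := by
  rw [← map_pow, FiniteField.pow_card]

section TraceSums

variable {F K : Type*} [Field F] [Field K] [Fintype F] [Fintype K] [Algebra F K]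

theorem sum_pow_card {M : Type*} [AddCommMonoid M] (f : K → M) :
    ∑ z, f (z ^ Fintype.card F) = ∑ z, f z :=
  Equiv.sum_comp (FiniteField.frobeniusAlgEquivOfAlgebraic F K).toEquiv f

theorem trace_pow_card (x : K) :
    Algebra.trace F K (x ^ Fintype.card F) = Algebra.trace F K x :=
  Algebra.trace_eq_of_algEquiv (FiniteField.frobeniusAlgEquivOfAlgebraic F K) x

theorem sum_char_mul [DecidableEq F] {ψ : AddChar F ℂ} (hψ : ψ.IsPrimitive) (b : F) :
    ∑ c : F, ψ (c * b) = if b = 0 then (Fintype.card F : ℂ) else 0 := by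
  rw [AddChar.sum_mulShift b hψ]; split_ifs <;> simp

theorem sum_char_trace_mul [DecidableEq K] {ψ : AddChar F ℂ} (hψ : ψ.IsPrimitive) (b : K) :
    ∑ z : K, ψ (Algebra.trace F K (b * z)) = if b = 0 then (Fintype.card K : ℂ) else 0 := by
  let Ψ : AddChar K ℂ := ψ.compAddMonoidHom (Algebra.trace F K).toAddMonoidHom
  have hΨ : Ψ ≠ 1 := by
    intro h
    have h1 : ψ ≠ 1 := by
      have := hψ (one_ne_zero)
      rwa [AddChar.mulShift_one] at this
    apply h1
    ext c
    obtain ⟨x, rfl⟩ := Algebra.trace_surjective F K c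
    exact DFunLike.congr_fun h x
  have := AddChar.sum_mulShift b (AddChar.IsPrimitive.of_ne_one hΨ)
  simp only [mul_comm b]
  refine Eq.trans this ?_
  split_ifs <;> simp

variable (F) in
/-- The exponential sum `∑ ψ(Tr(a y^(q+1)))` over `y ∈ K`, where `q = |F|`. -/
noncomputable def normPowerSum (ψ : AddChar F ℂ) (a : K) : ℂ :=
  ∑ y : K, ψ (Algebra.trace F K (a * y ^ (Fintype.card F + 1)))

theorem normPowerSum_zero (ψ : AddChar F ℂ) :
    normPowerSum F ψ (0 : K) = Fintype.card K := by
  simp [normPowerSum]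

theorem normPowerSum_mul_pow (ψ : AddChar F ℂ) (a : K) {b : K} (hb : b ≠ 0) :
    normPowerSum F ψ (a * b ^ (Fintype.card F + 1)) = normPowerSum F ψ a := by
  unfold normPowerSum
  rw [← Equiv.sum_comp (Equiv.mulLeft₀ b hb)
    (fun y => ψ (Algebra.trace F K (a * y ^ (Fintype.card F + 1))))]
  refine sum_congr rfl fun y _ => ?_
  simp [mul_pow, mul_assoc]

/-- Summing over all `a` leaves only the contribution of `y = 0`. -/
theorem sum_normPowerSum {ψ : AddChar F ℂ} (hψ : ψ.IsPrimitive) :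
    ∑ a : K, normPowerSum F ψ a = Fintype.card K := by
  classical
  unfold normPowerSum
  rw [sum_comm]
  simp_rw [mul_comm _ (_ ^ _), sum_char_trace_mul hψ]
  simp

/-- Multiplying `normPowerSum` by its conjugate and substituting `y + z` for `y` makes the inner
sum linear in `z ^ q`; it survives only for `y` in the radical of the Hermitian form. -/
theorem normPowerSum_mul_normPowerSum_neg {ψ : AddChar F ℂ} (hψ : ψ.IsPrimitive) (a : K)
    [DecidableEq K] :
    normPowerSum F ψ a * normPowerSum F ψ (-a) =
      Fintype.card K * ∑ y ∈ univ.filter (fun y : K =>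
        a ^ Fintype.card F * y ^ (Fintype.card F ^ 2) + a * y = 0),
        ψ (Algebra.trace F K (a * y ^ (Fintype.card F + 1))) := by
  set q := Fintype.card F with hq
  have key : ∀ y z : K, Algebra.trace F K (a * (y + z) ^ (q + 1)) +
      Algebra.trace F K (-a * z ^ (q + 1)) = Algebra.trace F K (a * y ^ (q + 1)) +
      Algebra.trace F K ((a ^ q * y ^ (q ^ 2) + a * y) * z ^ q) := by
    intro y z
    have h1 : Algebra.trace F K (a ^ q * y ^ (q ^ 2) * z ^ q) =
        Algebra.trace F K (a * y ^ q * z) := by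
      rw [← trace_pow_card (F := F) (a * y ^ q * z), ← hq]
      congr 1
      ring
    rw [add_mul, map_add, h1, ← map_add, ← map_add, ← map_add, pow_succ, hq, add_pow_card, ← hq]
    congr 1
    ring
  unfold normPowerSum
  rw [← hq, mul_comm (∑ y, _), sum_mul_sum]
  have h2 : ∀ z : K, ∑ y : K, ψ (Algebra.trace F K (-a * z ^ (q + 1))) *
      ψ (Algebra.trace F K (a * y ^ (q + 1))) = ∑ y : K,
      ψ (Algebra.trace F K (a * y ^ (q + 1))) *
        ψ (Algebra.trace F K ((a ^ q * y ^ (q ^ 2) + a * y) * z ^ q)) := by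
    intro z
    rw [← Equiv.sum_comp (Equiv.addRight z) (fun y => ψ (Algebra.trace F K (-a * z ^ (q + 1))) *
      ψ (Algebra.trace F K (a * y ^ (q + 1))))]
    refine sum_congr rfl fun y _ => ?_
    rw [← AddChar.map_add_eq_mul, ← AddChar.map_add_eq_mul, ← key, add_comm]
    rfl
  simp_rw [h2]
  rw [sum_comm]
  simp_rw [← mul_sum]
  have h3 : ∀ b : K, ∑ z : K, ψ (Algebra.trace F K (b * z ^ q)) =
      if b = 0 then (Fintype.card K : ℂ) else 0 := fun b => by
    rw [hq, sum_pow_card (F := F) (fun z : K => ψ (Algebra.trace F K (b * z))),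
      sum_char_trace_mul hψ]
  simp_rw [h3, mul_ite, mul_zero]
  rw [← sum_filter, mul_sum]
  exact sum_congr rfl fun y _ => mul_comm _ _

/-- The sum over all `F`-multiples of `a` counts the zeros of `y ↦ Tr(a y^(q+1))`. -/
theorem sum_normPowerSum_algebraMap_mul {ψ : AddChar F ℂ} (hψ : ψ.IsPrimitive) [DecidableEq F]
    (a : K) : ∑ c : F, normPowerSum F ψ (algebraMap F K c * a) =
      Fintype.card F * #{y : K | Algebra.trace F K (a * y ^ (Fintype.card F + 1)) = 0} := by
  unfold normPowerSum
  rw [sum_comm]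
  simp_rw [mul_assoc, ← Algebra.smul_def, map_smul, smul_eq_mul, sum_char_mul hψ]
  rw [← sum_filter, sum_const, nsmul_eq_mul, mul_comm]

end TraceSums

/-! ### The radical of the Hermitian form -/

theorem pow_card_eq_self_iff_mem_range {E K : Type*} [Field E] [Field K] [Fintype E]
    [Algebra E K] {z : K} :
    z ^ Fintype.card E = z ↔ ∃ y : E, algebraMap E K y = z := by
  classical
  constructor
  · intro hz
    have h1 : 1 < Fintype.card E := Fintype.one_lt_card
    have hne : (Polynomial.X ^ Fintype.card E - Polynomial.X : Polynomial K) ≠ 0 :=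
      FiniteField.X_pow_card_sub_X_ne_zero K h1
    by_contra! hcon
    have hsub : insert z (univ.image (algebraMap E K)) ⊆
        (Polynomial.X ^ Fintype.card E - Polynomial.X : Polynomial K).roots.toFinset := by
      intro x hx
      rw [Multiset.mem_toFinset, Polynomial.mem_roots hne]
      rcases mem_insert.1 hx with rfl | hx
      · simp [hz]
      · obtain ⟨y, -, rfl⟩ := mem_image.1 hx
        simp [algebraMap_pow_card, -map_pow]
    have h2 := card_le_card hsub
    rw [card_insert_of_notMem (by simpa using hcon),
      card_image_of_injective _ (algebraMap E K).injective, card_univ] at h2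
    have h3 := Multiset.toFinset_card_le
      (Polynomial.X ^ Fintype.card E - Polynomial.X : Polynomial K).roots
    have h4 := Polynomial.card_roots' (Polynomial.X ^ Fintype.card E - Polynomial.X : Polynomial K)
    rw [FiniteField.X_pow_card_sub_X_natDegree_eq K h1] at h4
    omega
  · rintro ⟨y, rfl⟩
    exact algebraMap_pow_card y

theorem algebraMap_trace_of_card_sq {F E : Type*} [Field F] [Field E] [Fintype F] [Fintype E]
    [Algebra F E] (hE : Fintype.card E = Fintype.card F ^ 2) (y : E) :
    algebraMap F E (Algebra.trace F E y) = y + y ^ Fintype.card F := by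
  have h : Module.finrank F E = 2 := by
    have := Module.card_eq_pow_finrank (K := F) (V := E)
    rw [hE] at this
    exact (Nat.pow_right_injective Fintype.one_lt_card this).symm
  rw [FiniteField.algebraMap_trace_eq_sum_pow, h, sum_range_succ, sum_range_one,
    Nat.card_eq_fintype_card]
  simp

/-- The Hermitian form vanishes on its radical. -/
theorem trace_eq_zero_of_mem_radical {F K : Type*} (E : Type*) [Field F] [Field E] [Field K]
    [Fintype F] [Fintype E] [Fintype K] [Algebra F E] [Algebra E K] [Algebra F K]
    (hE : Fintype.card E = Fintype.card F ^ 2) {a y : K}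
    (h : a ^ Fintype.card F * y ^ (Fintype.card F ^ 2) + a * y = 0) :
    Algebra.trace F K (a * y ^ (Fintype.card F + 1)) = 0 := by
  set q := Fintype.card F with hq
  set u := a * y ^ (q + 1) with hu
  have hu' : u ^ q = -u := by
    have : a ^ q * y ^ (q ^ 2) = -(a * y) := eq_neg_of_add_eq_zero_left h
    calc u ^ q = (a ^ q * y ^ (q ^ 2)) * y ^ q := by rw [hu]; ring
      _ = -u := by rw [this, hu]; ring
  -- An element of trace `1` in `E` replaces division by `2`, so that every characteristic works.
  obtain ⟨t, ht⟩ := Algebra.trace_surjective F E 1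
  have h1 : algebraMap E K t + algebraMap E K t ^ q = 1 := by
    rw [← map_pow, ← map_add, ← algebraMap_trace_of_card_sq hE, ht, map_one, map_one]
  have h2 := trace_pow_card (F := F) (algebraMap E K t * u)
  rw [mul_pow, ← hq, hu', mul_neg, map_neg, neg_eq_iff_add_eq_zero, ← map_add, ← add_mul,
    add_comm, h1, one_mul] at h2
  exact h2

/-- The radical is an `E`-space of dimension at most one, so it has `1` or `q ^ 2` elements. -/
theorem card_radical {F K : Type*} (E : Type*) [Fintype F] [Field E] [Field K]
    [Fintype E] [Fintype K] [Algebra E K] (hE : Fintype.card E = Fintype.card F ^ 2)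
    {a : K} [DecidableEq K]
    (h : ∃ y : K, y ≠ 0 ∧ a ^ Fintype.card F * y ^ (Fintype.card F ^ 2) + a * y = 0)
    (ha : a ≠ 0) :
    #{y : K | a ^ Fintype.card F * y ^ (Fintype.card F ^ 2) + a * y = 0} =
      Fintype.card F ^ 2 := by
  obtain ⟨y, hy, hya⟩ := h
  have : ({z : K | a ^ Fintype.card F * z ^ (Fintype.card F ^ 2) + a * z = 0} : Finset K) =
      univ.image (fun t : E => algebraMap E K t * y) := by
    ext z
    simp only [mem_filter, mem_univ, true_and, mem_image]
    have e1 : a ^ Fintype.card F * z ^ (Fintype.card F ^ 2) + a * z = 0 ↔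
        (z / y) ^ Fintype.card E = z / y := by
      rw [hE, div_pow]
      have h3 : a ^ Fintype.card F * y ^ (Fintype.card F ^ 2) = -(a * y) :=
        eq_neg_of_add_eq_zero_left hya
      have hy2 := pow_ne_zero (Fintype.card F ^ 2) hy
      have ha2 := pow_ne_zero (Fintype.card F) ha
      rw [div_eq_div_iff hy2 hy]
      constructor
      · intro h4
        apply mul_left_cancel₀ ha2
        linear_combination y * h4 - z * h3
      · intro h4
        apply mul_left_cancel₀ hy
        linear_combination (a ^ Fintype.card F) * h4 + z * h3
    rw [e1, pow_card_eq_self_iff_mem_range]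
    refine exists_congr fun t => ?_
    rw [eq_div_iff hy]
  rw [this, card_image_of_injective, card_univ, hE]
  intro s t hst
  exact (algebraMap E K).injective (mul_right_cancel₀ hy hst)

/-! ### Counting along the powers of a primitive element -/

theorem card_filter_range_mul_of_periodic {p : ℕ → Prop} [DecidablePred p] {M : ℕ}
    (hp : Function.Periodic p M) (t : ℕ) :
    #{i ∈ range (M * t) | p i} = t * #{i ∈ range M | p i} := by
  induction t with
  | zero => simp
  | succ t ih =>
    rw [← Nat.count_eq_card_filter_range] at ih ⊢
    have h : ∀ i, p (M * t + i) ↔ p i := fun i => by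
      have := hp.nat_mul t i
      rw [add_comm, mul_comm]
      exact iff_of_eq this
    rw [Nat.mul_succ, Nat.count_add, ih]
    simp only [h]
    rw [Nat.count_eq_card_filter_range]
    ring

section Primitive

variable {K : Type*} [Field K] [Fintype K] {α : Kˣ}

theorem pow_eq_one_iff_card_sub_one_dvd (hα : ∀ x : Kˣ, x ∈ Subgroup.zpowers α) (j : ℕ) :
    (α : K) ^ j = 1 ↔ Fintype.card K - 1 ∣ j := by
  classical
  rw [← Fintype.card_units, ← Nat.card_eq_fintype_card,
    ← orderOf_eq_card_of_forall_mem_zpowers hα, orderOf_dvd_iff_pow_eq_one, ← Units.val_pow_eq_pow_val,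
    Units.val_eq_one]

theorem exists_eq_pow_of_ne_zero (hα : ∀ x : Kˣ, x ∈ Subgroup.zpowers α) {x : K} (hx : x ≠ 0) :
    ∃ j : ℕ, x = (α : K) ^ j := by
  obtain ⟨j, hj⟩ := (mem_powers_iff_mem_zpowers.2 (hα (Units.mk0 x hx)))
  refine ⟨j, ?_⟩
  have := congrArg Units.val hj
  simpa using this.symm

theorem exists_eq_pow_mul_of_pow_eq_one (hα : ∀ x : Kˣ, x ∈ Subgroup.zpowers α) {s t : ℕ}
    (hst : Fintype.card K - 1 = s * t) {x : K} (hx : x ^ s = 1) :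
    ∃ i : ℕ, x = (α : K) ^ (t * i) := by
  have hpos : 0 < s * t := by
    rw [← hst]; exact Nat.sub_pos_of_lt Fintype.one_lt_card
  have hs : s ≠ 0 := by rintro rfl; simp at hpos
  have hx0 : x ≠ 0 := by rintro rfl; simp [hs] at hx
  obtain ⟨j, rfl⟩ := exists_eq_pow_of_ne_zero hα hx0
  rw [← pow_mul, pow_eq_one_iff_card_sub_one_dvd hα, hst, mul_comm j] at hx
  obtain ⟨i, rfl⟩ := Nat.dvd_of_mul_dvd_mul_left (Nat.pos_of_ne_zero hs) hx
  exact ⟨i, rfl⟩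

theorem pow_injOn_range (hα : ∀ x : Kˣ, x ∈ Subgroup.zpowers α) :
    Set.InjOn (fun j : ℕ => (α : K) ^ j) (range (Fintype.card K - 1)) := by
  classical
  intro i hi j hj hij
  rw [← Fintype.card_units, ← Nat.card_eq_fintype_card,
    ← orderOf_eq_card_of_forall_mem_zpowers hα] at hi hj
  refine pow_injOn_Iio_orderOf (by simpa using hi) (by simpa using hj) ?_
  apply Units.val_injective
  simpa using hij

theorem card_ne_zero_filter_eq (hα : ∀ x : Kˣ, x ∈ Subgroup.zpowers α) (p : K → Prop)
    [DecidablePred p] [DecidableEq K] :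
    #{y : K | y ≠ 0 ∧ p y} = #{j ∈ range (Fintype.card K - 1) | p ((α : K) ^ j)} := by
  symm
  refine card_bij (fun j _ => (α : K) ^ j) ?_ ?_ ?_
  · intro j hj
    simpa using (mem_filter.1 hj).2
  · intro i hi j hj hij
    exact pow_injOn_range hα (mem_coe.2 (mem_filter.1 hi).1) (mem_coe.2 (mem_filter.1 hj).1) hij
  · intro y hy
    obtain ⟨hy0, hy⟩ := (mem_filter.1 hy).2
    obtain ⟨j, rfl⟩ := exists_eq_pow_of_ne_zero hα hy0
    have hN : 0 < Fintype.card K - 1 := Nat.sub_pos_of_lt Fintype.one_lt_card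
    have hmod : (α : K) ^ (j % (Fintype.card K - 1)) = (α : K) ^ j := by
      conv_rhs => rw [← Nat.mod_add_div j (Fintype.card K - 1), pow_add, pow_mul,
        (pow_eq_one_iff_card_sub_one_dvd hα _).2 dvd_rfl, one_pow, mul_one]
    refine ⟨j % (Fintype.card K - 1), ?_, hmod⟩
    rw [mem_filter, mem_range]
    exact ⟨Nat.mod_lt _ hN, by rwa [hmod]⟩

end Primitive

theorem mul_sq_sub_one_eq {q M : ℕ} : M * (q ^ 2 - 1) = (q - 1) * (M * (q + 1)) := by
  have := Nat.sq_sub_sq q 1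
  rw [one_pow] at this
  rw [this]; ring

/-! ### Exponential sums and numbers of zeros -/

section Values

variable {F K : Type*} [Field F] [Field K] [Fintype F] [Fintype K] [Algebra F K] {α : Kˣ}
  {q M : ℕ}

theorem exists_pow_eq_algebraMap (hα : ∀ x : Kˣ, x ∈ Subgroup.zpowers α)
    (hF : Fintype.card F = q) (hM : Fintype.card K = M * (q ^ 2 - 1) + 1) {c : F} (hc : c ≠ 0) :
    ∃ b : K, b ≠ 0 ∧ b ^ (q + 1) = algebraMap F K c := by
  obtain ⟨i, hi⟩ := exists_eq_pow_mul_of_pow_eq_one hα (s := q - 1) (t := M * (q + 1))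
    (x := algebraMap F K c) (by rw [hM, Nat.add_sub_cancel, mul_sq_sub_one_eq]) (by
      rw [← map_pow, ← hF, FiniteField.pow_card_sub_one_eq_one c hc, map_one])
  refine ⟨(α : K) ^ (M * i), by simp, ?_⟩
  rw [hi, ← pow_mul]
  congr 1; ring

theorem exists_algebraMap_eq_pow (hα : ∀ x : Kˣ, x ∈ Subgroup.zpowers α)
    (hF : Fintype.card F = q) (hM : Fintype.card K = M * (q ^ 2 - 1) + 1) :
    ∃ c : F, c ≠ 0 ∧ algebraMap F K c = (α : K) ^ ((q + 1) * M) := by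
  have hq : 1 ≤ q := by rw [← hF]; exact Fintype.card_pos
  have h : ((α : K) ^ ((q + 1) * M)) ^ (q - 1) = 1 := by
    rw [← pow_mul, pow_eq_one_iff_card_sub_one_dvd hα, hM, Nat.add_sub_cancel, mul_sq_sub_one_eq]
    exact dvd_of_eq (by ring)
  obtain ⟨c, hc⟩ := (pow_card_eq_self_iff_mem_range (E := F) (z := (α : K) ^ ((q + 1) * M))).1 (by
    rw [hF]
    calc _ = ((α : K) ^ ((q + 1) * M)) ^ (q - 1 + 1) := by rw [Nat.sub_add_cancel hq]
      _ = _ := by rw [pow_succ, h, one_mul])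
  refine ⟨c, ?_, hc⟩
  rintro rfl
  rw [map_zero] at hc
  exact pow_ne_zero ((q + 1) * M) α.ne_zero hc.symm

theorem periodic_trace_eq_zero (hα : ∀ x : Kˣ, x ∈ Subgroup.zpowers α)
    (hF : Fintype.card F = q) (hM : Fintype.card K = M * (q ^ 2 - 1) + 1) (a : K) :
    Function.Periodic (fun i : ℕ => Algebra.trace F K (a * (α : K) ^ ((q + 1) * i)) = 0) M := by
  intro i
  obtain ⟨c, hc, hcα⟩ := exists_algebraMap_eq_pow (F := F) hα hF hM
  have : a * (α : K) ^ ((q + 1) * (i + M)) = c • (a * (α : K) ^ ((q + 1) * i)) := by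
    rw [Algebra.smul_def, hcα]; ring
  simp only [this, map_smul, smul_eq_mul, mul_eq_zero, hc, false_or]

theorem card_trace_eq_zero [DecidableEq F] (hα : ∀ x : Kˣ, x ∈ Subgroup.zpowers α)
    (hF : Fintype.card F = q) (hM : Fintype.card K = M * (q ^ 2 - 1) + 1) (a : K) :
    #{y : K | Algebra.trace F K (a * y ^ (q + 1)) = 0} =
      1 + (q ^ 2 - 1) * #{i ∈ range M | Algebra.trace F K (a * (α : K) ^ ((q + 1) * i)) = 0} := by
  classical
  rw [← card_filter_range_mul_of_periodic (periodic_trace_eq_zero hα hF hM a)]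
  have h := card_ne_zero_filter_eq hα (fun y : K => Algebra.trace F K (a * y ^ (q + 1)) = 0)
  rw [hM, Nat.add_sub_cancel] at h
  simp only [← pow_mul, mul_comm _ (q + 1)] at h
  rw [← h]
  have : (univ.filter fun y : K => Algebra.trace F K (a * y ^ (q + 1)) = 0) =
      insert 0 (univ.filter fun y : K => y ≠ 0 ∧ Algebra.trace F K (a * y ^ (q + 1)) = 0) := by
    ext y
    by_cases hy : y = 0 <;> simp [hy]
  rw [this, card_insert_of_notMem (by simp), add_comm]

/-- Every nonzero element of `F` is a `(q+1)`-th power in `K`, so the sum does not change when `a`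
is multiplied by it, and all `F`-multiples of `a` together express it by the number of zeros. -/
theorem normPowerSum_eq_card_zeros [DecidableEq F] {ψ : AddChar F ℂ}
    (hψ : ψ.IsPrimitive)
    (hα : ∀ x : Kˣ, x ∈ Subgroup.zpowers α)
    (hF : Fintype.card F = q) (hM : Fintype.card K = M * (q ^ 2 - 1) + 1) (a : K) :
    ((q : ℂ) - 1) * normPowerSum F ψ a + Fintype.card K = q * (1 + (q ^ 2 - 1) *
      #{i ∈ range M | Algebra.trace F K (a * (α : K) ^ ((q + 1) * i)) = 0}) := by
  classical
  have h := sum_normPowerSum_algebraMap_mul hψ a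
  have hq : 1 ≤ q := by rw [← hF]; exact Fintype.card_pos
  rw [hF, card_trace_eq_zero hα hF hM, ← add_sum_erase _ _ (mem_univ (0 : F)), map_zero, zero_mul,
    normPowerSum_zero] at h
  have h2 : ∀ c ∈ (univ : Finset F).erase 0,
      normPowerSum F ψ (algebraMap F K c * a) = normPowerSum F ψ a := by
    intro c hc
    obtain ⟨b, hb, hbc⟩ := exists_pow_eq_algebraMap hα hF hM (ne_of_mem_erase hc)
    rw [← hbc, mul_comm, ← hF, normPowerSum_mul_pow ψ a hb]
  rw [sum_congr rfl h2, sum_const, card_erase_of_mem (mem_univ _), card_univ, hF,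
    nsmul_eq_mul] at h
  have hq2 : 1 ≤ q ^ 2 := Nat.one_le_pow _ _ hq
  push_cast [hq, hq2] at h
  rw [← h]; ring

theorem normPowerSum_neg (ψ : AddChar F ℂ) (hα : ∀ x : Kˣ, x ∈ Subgroup.zpowers α)
    (hF : Fintype.card F = q) (hM : Fintype.card K = M * (q ^ 2 - 1) + 1) (a : K) :
    normPowerSum F ψ (-a) = normPowerSum F ψ a := by
  obtain ⟨b, hb, hbc⟩ := exists_pow_eq_algebraMap hα hF hM (c := (-1 : F)) (by simp)
  rw [← normPowerSum_mul_pow ψ a hb, hF, hbc]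
  simp

end Values

/-- The congruence modulo `q + 1` that fixes the sign of the exponential sum: `ε q^j` and
`(-q)^j` are both `1` modulo `q + 1`, which does not divide `2`. -/
theorem sign_eq_of_card_zeros {q M z ε : ℤ} {j : ℕ} {Q : ℤ} (hq : 2 ≤ q) (hε : ε = 1 ∨ ε = -1)
    (hQ : Q = M * (q ^ 2 - 1) + 1)
    (h : (q - 1) * (ε * q ^ j) + Q = q * (1 + (q ^ 2 - 1) * z)) : ε * q ^ j = (-q) ^ j := by
  have h1 : ε * q ^ j = 1 + (q + 1) * (q * z - M) := by
    apply mul_left_cancel₀ (show q - 1 ≠ 0 by omega)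
    linear_combination h - hQ
  have h2 : q + 1 ∣ q ^ j - (-1) ^ j := by
    have := sub_dvd_pow_sub_pow q (-1) j
    rwa [sub_neg_eq_add] at this
  obtain ⟨t, ht⟩ := h2
  have h3 : q + 1 ∣ ε * (-1) ^ j - 1 := ⟨q * z - M - ε * t, by linear_combination h1 - ε * ht⟩
  rw [neg_pow]
  rcases neg_one_pow_eq_or ℤ j with hj | hj <;> rcases hε with rfl | rfl <;> rw [hj] at h3 ⊢
  · have := Int.le_of_dvd (by norm_num) ((dvd_neg).2 h3)
    omega
  · have := Int.le_of_dvd (by norm_num) ((dvd_neg).2 h3)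
    omega

/-! ### Evaluation of the sums and the resulting weights -/

section Radical

variable {F K : Type*} [Field F] [Field K] [Fintype F] [Fintype K] [Algebra F K]

variable (F) in
/-- The Hermitian form `y ↦ Tr(a y^(q+1))` is degenerate: the additive polynomial
`a^q y^(q^2) + a y` defining its radical has a nonzero root. -/
def IsDegenerate (a : K) : Prop :=
  ∃ y : K, y ≠ 0 ∧ a ^ Fintype.card F * y ^ (Fintype.card F ^ 2) + a * y = 0

variable {α : Kˣ} {q M l : ℕ} [DecidableEq F]

open Classical in
theorem normPowerSum_eq_ite (E : Type*) [Field E] [Fintype E] [Algebra F E] [Algebra E K]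
    [IsScalarTower F E K] {ψ : AddChar F ℂ} (hψ : ψ.IsPrimitive)
    (hα : ∀ x : Kˣ, x ∈ Subgroup.zpowers α)
    (hF : Fintype.card F = q) (hE : Fintype.card E = q ^ 2)
    (hM : Fintype.card K = M * (q ^ 2 - 1) + 1) (hl : Fintype.card K = q ^ (2 * l))
    {a : K} (ha : a ≠ 0) :
    normPowerSum F ψ a = if IsDegenerate F a then (-q : ℂ) ^ (l + 1) else (-q : ℂ) ^ l := by
  have hE' : Fintype.card E = Fintype.card F ^ 2 := by rw [hE, hF]
  have hq : 2 ≤ q := by rw [← hF]; exact Fintype.one_lt_card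
  have hsq := normPowerSum_mul_normPowerSum_neg hψ a
  rw [normPowerSum_neg ψ hα hF hM] at hsq
  have hsum : ∑ y ∈ univ.filter (fun y : K =>
        a ^ Fintype.card F * y ^ (Fintype.card F ^ 2) + a * y = 0),
        ψ (Algebra.trace F K (a * y ^ (Fintype.card F + 1))) =
      #{y : K | a ^ Fintype.card F * y ^ (Fintype.card F ^ 2) + a * y = 0} := by
    rw [sum_congr rfl (g := fun _ => (1 : ℂ)) (fun y hy => by
      rw [trace_eq_zero_of_mem_radical E hE' (mem_filter.1 hy).2, AddChar.map_zero_eq_one])]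
    simp
  rw [hsum, hl] at hsq
  have main : ∀ j : ℕ, normPowerSum F ψ a * normPowerSum F ψ a = ((q : ℂ) ^ j) * (q : ℂ) ^ j →
      normPowerSum F ψ a = (-q : ℂ) ^ j := by
    intro j hj
    obtain ⟨ε, hε, hS⟩ : ∃ ε : ℤ, (ε = 1 ∨ ε = -1) ∧ normPowerSum F ψ a = ε * (q : ℂ) ^ j := by
      rcases mul_self_eq_mul_self_iff.1 hj with h | h
      · exact ⟨1, Or.inl rfl, by simpa using h⟩
      · exact ⟨-1, Or.inr rfl, by simpa using h⟩
    have hz := normPowerSum_eq_card_zeros hψ hα hF hM a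
    have hz' : ((q : ℤ) - 1) * (ε * (q : ℤ) ^ j) + (Fintype.card K : ℤ) = q * (1 + (q ^ 2 - 1) *
      (#{i ∈ range M | Algebra.trace F K (a * (α : K) ^ ((q + 1) * i)) = 0} : ℤ)) := by
      rw [hS] at hz
      exact_mod_cast hz
    have hq2 : 1 ≤ q ^ 2 := Nat.one_le_pow _ _ (by omega)
    have := sign_eq_of_card_zeros (M := M) (by exact_mod_cast hq) hε
      (by rw [hM]; push_cast [hq2]; ring) hz'
    rw [hS]
    exact_mod_cast congrArg (Int.cast : ℤ → ℂ) this
  split_ifs with hdeg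
  · apply main
    rw [hsq, card_radical E hE' hdeg ha, hF]
    push_cast; ring
  · apply main
    have : ({y : K | a ^ Fintype.card F * y ^ (Fintype.card F ^ 2) + a * y = 0} : Finset K) =
        {0} := by
      ext y
      simp only [mem_filter, mem_univ, true_and, mem_singleton]
      constructor
      · intro hy
        by_contra hy0
        exact hdeg ⟨y, hy0, hy⟩
      · rintro rfl; simp
    rw [hsq, this]
    push_cast; simp; ring

/-- The number of degenerate forms follows from the sum of all the exponential sums. -/
theorem card_isDegenerate (E : Type*) [Field E] [Fintype E] [Algebra F E] [Algebra E K]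
    [IsScalarTower F E K]
    (hα : ∀ x : Kˣ, x ∈ Subgroup.zpowers α)
    (hF : Fintype.card F = q) (hE : Fintype.card E = q ^ 2)
    (hM : Fintype.card K = M * (q ^ 2 - 1) + 1) (hl : Fintype.card K = q ^ (2 * l)) :
    {a : K | a ≠ 0 ∧ IsDegenerate F a}.ncard * (q + 1) = Fintype.card K - 1 ∧
    {a : K | a ≠ 0 ∧ ¬ IsDegenerate F a}.ncard * (q + 1) = q * (Fintype.card K - 1) := by
  classical
  have hψ := AddChar.FiniteField.primitiveChar_to_Complex_isPrimitive F
  set ψ := AddChar.FiniteField.primitiveChar_to_Complex F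
  have hq : 2 ≤ q := by rw [← hF]; exact Fintype.one_lt_card
  set A : Finset K := {a : K | a ≠ 0 ∧ IsDegenerate F a} with hA
  set B : Finset K := {a : K | a ≠ 0 ∧ ¬ IsDegenerate F a} with hB
  have eA : {a : K | a ≠ 0 ∧ IsDegenerate F a}.ncard = #A := by
    rw [← Set.ncard_coe_finset]; simp [hA]
  have eB : {a : K | a ≠ 0 ∧ ¬ IsDegenerate F a}.ncard = #B := by
    rw [← Set.ncard_coe_finset]; simp [hB]
  have hAB : #A + #B = Fintype.card K - 1 := by
    rw [← card_univ (α := K), ← card_erase_of_mem (mem_univ (0 : K)),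
      ← card_filter_add_card_filter_not (s := (univ : Finset K).erase 0) (IsDegenerate F)]
    congr 2 <;> ext a <;> simp [hA, hB]
  have hs := sum_normPowerSum (F := F) (K := K) hψ
  rw [← add_sum_erase _ _ (mem_univ (0 : K)), normPowerSum_zero, add_eq_left,
    sum_congr rfl (fun a ha => normPowerSum_eq_ite E hψ hα hF hE hM hl (ne_of_mem_erase ha)),
    sum_ite, sum_const, sum_const] at hs
  have e1 : ((univ : Finset K).erase 0).filter (IsDegenerate F) = A := by ext; simp [hA]
  have e2 : ((univ : Finset K).erase 0).filter (fun a => ¬ IsDegenerate F a) = B := by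
    ext; simp [hB]
  rw [e1, e2, nsmul_eq_mul, nsmul_eq_mul] at hs
  have hq0 : (-q : ℂ) ≠ 0 := by
    simp only [ne_eq, neg_eq_zero, Nat.cast_eq_zero]; omega
  have h3 : (#B : ℂ) = q * #A := by
    apply mul_left_cancel₀ (pow_ne_zero l hq0)
    linear_combination hs
  have h4 : #B = q * #A := by exact_mod_cast h3
  rw [eA, eB, ← hAB, h4]
  constructor <;> ring

/-- `q (q + 1)` times the Hamming weight in terms of the exponential sum. -/
theorem card_trace_ne_zero (E : Type*) [Field E] [Fintype E] [Algebra F E] [Algebra E K]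
    [IsScalarTower F E K]
    (hα : ∀ x : Kˣ, x ∈ Subgroup.zpowers α)
    (hF : Fintype.card F = q) (hE : Fintype.card E = q ^ 2)
    (hM : Fintype.card K = M * (q ^ 2 - 1) + 1) (hl : Fintype.card K = q ^ (2 * l))
    {a : K} (ha : a ≠ 0) :
    (IsDegenerate F a → (q : ℤ) * ((q + 1) *
      #{i ∈ range (M * (q - 1)) | Algebra.trace F K (a * (α : K) ^ ((q + 1) * i)) ≠ 0}) =
        (q - 1) * (q ^ (2 * l) - (-q) ^ (l + 1))) ∧
    (¬ IsDegenerate F a → (q : ℤ) * ((q + 1) *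
      #{i ∈ range (M * (q - 1)) | Algebra.trace F K (a * (α : K) ^ ((q + 1) * i)) ≠ 0}) =
        (q - 1) * (q ^ (2 * l) - (-q) ^ l)) := by
  have hψ := AddChar.FiniteField.primitiveChar_to_Complex_isPrimitive F
  set ψ := AddChar.FiniteField.primitiveChar_to_Complex F
  have hq : 2 ≤ q := by rw [← hF]; exact Fintype.one_lt_card
  have hper : Function.Periodic
      (fun i : ℕ => Algebra.trace F K (a * (α : K) ^ ((q + 1) * i)) ≠ 0) M := fun i => by
    have := periodic_trace_eq_zero hα hF hM a i
    simp only at this ⊢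
    rw [ne_eq, this]
  have hS := normPowerSum_eq_ite E hψ hα hF hE hM hl ha
  have hz := normPowerSum_eq_card_zeros hψ hα hF hM a
  rw [card_filter_range_mul_of_periodic hper]
  have hc := card_filter_add_card_filter_not (s := range M)
    (fun i : ℕ => Algebra.trace F K (a * (α : K) ^ ((q + 1) * i)) = 0)
  rw [card_range] at hc
  have hq2 : 1 ≤ q ^ 2 := Nat.one_le_pow _ _ (by omega)
  have hq1 : 1 ≤ q := by omega
  have hM' : (q : ℤ) ^ (2 * l) = M * (q ^ 2 - 1) + 1 := by
    have := hl.symm.trans hM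
    zify [hq2] at this
    exact this
  have main : ∀ s : ℤ, normPowerSum F ψ a = s → (q : ℤ) * ((q + 1) * ((q - 1 : ℕ) *
      #{i ∈ range M | Algebra.trace F K (a * (α : K) ^ ((q + 1) * i)) ≠ 0} : ℕ)) =
        (q - 1) * (q ^ (2 * l) - s) := by
    intro s hs
    rw [hs, hl] at hz
    have hz' : ((q : ℤ) - 1) * s + (q : ℤ) ^ (2 * l) = q * (1 + (q ^ 2 - 1) *
      (#{i ∈ range M | Algebra.trace F K (a * (α : K) ^ ((q + 1) * i)) = 0} : ℤ)) := by
      exact_mod_cast hz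
    have hc' := congrArg (Nat.cast : ℕ → ℤ) hc
    push_cast [hq1] at hc' ⊢
    linear_combination (q : ℤ) * (q ^ 2 - 1) * hc' + hz' - (q : ℤ) * hM'
  constructor
  · intro h
    rw [if_pos h] at hS
    exact main ((-q) ^ (l + 1)) (by rw [hS]; push_cast; rfl)
  · intro h
    rw [if_neg h] at hS
    exact main ((-q) ^ l) (by rw [hS]; push_cast; rfl)

end Radical

/-! ### Codes with two weights -/

section Codes

variable {F : Type*} [Field F] [DecidableEq F]

/-- A linear code parametrized by a space `V` whose nonzero vectors fall into two nonempty classes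
of constant weights `w₁ < w₂`. -/
theorem hasParameters_and_weightEnumerator_of_two_weights {V : Type*} [AddCommGroup V] [Module F V]
    {n : ℕ} (φ : V →ₗ[F] Fin n → F) (P : V → Prop) {w₁ w₂ : ℕ} (h₀ : 0 < w₁) (h₁₂ : w₁ < w₂)
    (h₁ : ∀ v, v ≠ 0 → P v → hammingNorm (φ v) = w₁)
    (h₂ : ∀ v, v ≠ 0 → ¬ P v → hammingNorm (φ v) = w₂)
    (hN₁ : {v | v ≠ 0 ∧ P v}.ncard ≠ 0) (hN₂ : {v | v ≠ 0 ∧ ¬ P v}.ncard ≠ 0) :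
    LinCode.HasParameters (LinearMap.range φ) (Module.finrank F V) w₁ ∧
    LinCode.IsWeightCode 2 (LinearMap.range φ) ∧
    LinCode.weightEnumerator (LinearMap.range φ) =
      1 + Polynomial.C {v | v ≠ 0 ∧ P v}.ncard * Polynomial.X ^ w₁
        + Polynomial.C {v | v ≠ 0 ∧ ¬ P v}.ncard * Polynomial.X ^ w₂ := by
  have hpos : ∀ v, v ≠ 0 → w₁ ≤ hammingNorm (φ v) := by
    intro v hv
    by_cases hP : P v
    · exact (h₁ v hv hP).ge
    · exact h₁₂.le.trans (h₂ v hv hP).ge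
  have hinj : Function.Injective φ := by
    rw [injective_iff_map_eq_zero]
    intro v hv
    by_contra hne
    have := hpos v hne
    rw [hv, hammingNorm_zero] at this
    omega
  obtain ⟨v₁, hv₁, hP₁⟩ := Set.nonempty_of_ncard_ne_zero hN₁
  obtain ⟨v₂, hv₂, hP₂⟩ := Set.nonempty_of_ncard_ne_zero hN₂
  have hle : ∀ v, hammingNorm (φ v) ≤ n := fun v => by
    simpa using hammingNorm_le_card_fintype (x := φ v)
  have hw₁n : w₁ ≤ n := h₁ v₁ hv₁ hP₁ ▸ hle v₁
  have hw₂n : w₂ ≤ n := h₂ v₂ hv₂ hP₂ ▸ hle v₂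
  have hcount : ∀ i, LinCode.weightCount (LinearMap.range φ) i =
      {v | hammingNorm (φ v) = i}.ncard := by
    intro i
    rw [LinCode.weightCount, ← Set.ncard_image_of_injective _ hinj]
    congr 1
    ext c
    constructor
    · rintro ⟨⟨v, rfl⟩, hc⟩
      exact ⟨v, hc, rfl⟩
    · rintro ⟨v, hv, rfl⟩
      exact ⟨⟨v, rfl⟩, hv⟩
  have hc₁ : LinCode.weightCount (LinearMap.range φ) w₁ = {v | v ≠ 0 ∧ P v}.ncard := by
    rw [hcount]
    congr 1
    ext v
    constructor
    · intro (hv : hammingNorm (φ v) = w₁)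
      have hv0 : v ≠ 0 := by
        rintro rfl
        rw [map_zero, hammingNorm_zero] at hv
        omega
      refine ⟨hv0, ?_⟩
      by_contra hP
      have := h₂ v hv0 hP
      omega
    · rintro ⟨hv, hP⟩
      exact h₁ v hv hP
  have hc₂ : LinCode.weightCount (LinearMap.range φ) w₂ = {v | v ≠ 0 ∧ ¬ P v}.ncard := by
    rw [hcount]
    congr 1
    ext v
    constructor
    · intro (hv : hammingNorm (φ v) = w₂)
      have hv0 : v ≠ 0 := by
        rintro rfl
        rw [map_zero, hammingNorm_zero] at hv
        omega
      refine ⟨hv0, ?_⟩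
      intro hP
      have := h₁ v hv0 hP
      omega
    · rintro ⟨hv, hP⟩
      exact h₂ v hv hP
  have hc : ∀ i ∈ Icc 1 n, i ∉ ({w₁, w₂} : Finset ℕ) →
      LinCode.weightCount (LinearMap.range φ) i = 0 := by
    intro i hi hi'
    rw [mem_Icc] at hi
    rw [mem_insert, mem_singleton, not_or] at hi'
    suffices h : {v | hammingNorm (φ v) = i} = ∅ by rw [hcount, h, Set.ncard_empty]
    refine Set.eq_empty_of_forall_notMem fun v (hv : hammingNorm (φ v) = i) => ?_
    by_cases hv0 : v = 0
    · rw [hv0, map_zero, hammingNorm_zero] at hv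
      omega
    · by_cases hP : P v
      · exact hi'.1 (hv ▸ h₁ v hv0 hP)
      · exact hi'.2 (hv ▸ h₂ v hv0 hP)
  have hsub : ({w₁, w₂} : Finset ℕ) ⊆ Icc 1 n := by
    intro i hi
    rw [mem_insert, mem_singleton] at hi
    rw [mem_Icc]
    omega
  refine ⟨⟨LinearMap.finrank_range_of_inj hinj, ?_, ?_⟩, ?_, ?_⟩
  · refine ⟨φ v₁, ⟨v₁, rfl⟩, 0, zero_mem _, ?_, ?_⟩
    · rw [← map_zero φ]
      exact hinj.ne hv₁
    · rw [hammingDist_zero_right, h₁ v₁ hv₁ hP₁]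
  · rintro t ⟨_, ⟨u, rfl⟩, _, ⟨v, rfl⟩, huv, rfl⟩
    rw [hammingDist_eq_hammingNorm, neg_add_eq_sub, ← map_sub]
    exact hpos _ (sub_ne_zero.2 fun h => huv (by rw [h]))
  · have : ((Icc 1 n).filter fun i => LinCode.weightCount (LinearMap.range φ) i ≠ 0) =
        {w₁, w₂} := by
      ext i
      rw [mem_filter]
      constructor
      · rintro ⟨hi, hne⟩
        by_contra h
        exact hne (hc i hi h)
      · intro hi
        refine ⟨hsub hi, ?_⟩
        rw [mem_insert, mem_singleton] at hi
        rcases hi with rfl | rfl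
        · rwa [hc₁]
        · rwa [hc₂]
    rw [LinCode.IsWeightCode, this, card_pair h₁₂.ne]
  · rw [LinCode.weightEnumerator, ← sum_subset hsub fun i hi hi' => by rw [hc i hi hi']; simp,
      sum_pair h₁₂.ne, hc₁, hc₂, add_assoc]

/-- The two-weight criterion with weights and multiplicities given as exact quotients by `s`. -/
theorem hasParameters_and_weightEnumerator_of_two_weights_div {V : Type*} [AddCommGroup V]
    [Module F V] {n : ℕ} (φ : V →ₗ[F] Fin n → F) (P : V → Prop) {s a₁ a₂ b₁ b₂ : ℕ} (hs : 0 < s)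
    (h₀ : 0 < a₁) (h₁₂ : a₁ < a₂)
    (h₁ : ∀ v, v ≠ 0 → P v → s * hammingNorm (φ v) = a₁)
    (h₂ : ∀ v, v ≠ 0 → ¬ P v → s * hammingNorm (φ v) = a₂)
    (hb₁ : b₁ ≠ 0) (hb₂ : b₂ ≠ 0)
    (hN₁ : {v | v ≠ 0 ∧ P v}.ncard * s = b₁) (hN₂ : {v | v ≠ 0 ∧ ¬ P v}.ncard * s = b₂) :
    LinCode.HasParameters (LinearMap.range φ) (Module.finrank F V) (a₁ / s) ∧
    LinCode.IsWeightCode 2 (LinearMap.range φ) ∧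
    LinCode.weightEnumerator (LinearMap.range φ) =
      1 + Polynomial.C (b₁ / s) * Polynomial.X ^ (a₁ / s)
        + Polynomial.C (b₂ / s) * Polynomial.X ^ (a₂ / s) := by
  have hn₁ : {v | v ≠ 0 ∧ P v}.ncard ≠ 0 := fun h => hb₁ (by rw [← hN₁, h, zero_mul])
  have hn₂ : {v | v ≠ 0 ∧ ¬ P v}.ncard ≠ 0 := fun h => hb₂ (by rw [← hN₂, h, zero_mul])
  obtain ⟨v₁, hv₁, hP₁⟩ := Set.nonempty_of_ncard_ne_zero hn₁
  obtain ⟨v₂, hv₂, hP₂⟩ := Set.nonempty_of_ncard_ne_zero hn₂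
  obtain ⟨w₁, rfl⟩ : ∃ w, a₁ = s * w := ⟨_, (h₁ v₁ hv₁ hP₁).symm⟩
  obtain ⟨w₂, rfl⟩ : ∃ w, a₂ = s * w := ⟨_, (h₂ v₂ hv₂ hP₂).symm⟩
  rw [← hN₁, ← hN₂, Nat.mul_div_cancel _ hs, Nat.mul_div_cancel _ hs,
    Nat.mul_div_cancel_left _ hs, Nat.mul_div_cancel_left _ hs]
  exact hasParameters_and_weightEnumerator_of_two_weights φ P (Nat.pos_of_mul_pos_left h₀)
    (Nat.lt_of_mul_lt_mul_left h₁₂) (fun v hv hP => Nat.eq_of_mul_eq_mul_left hs (h₁ v hv hP))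
    (fun v hv hP => Nat.eq_of_mul_eq_mul_left hs (h₂ v hv hP)) hn₁ hn₂

end Codes

/-! ### The defining set as a coset -/

section Tower

variable {F E K : Type*} [Field F] [Field E] [Field K] [Fintype F] [Fintype E] [Fintype K]
  [Algebra F E] [Algebra E K] {q M : ℕ}

theorem mem_definingSet_zero_iff (hF : Fintype.card F = q)
    (hE : Fintype.card E = q ^ 2) (hM : Fintype.card K = M * (q ^ 2 - 1) + 1) {x : K} :
    x ∈ LinCode.definingSet F E K 0 ↔ x ^ (M * (q - 1)) = -1 := by
  have hq : 2 ≤ q := by rw [← hF]; exact Fintype.one_lt_card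
  have hE' : Fintype.card E = Fintype.card F ^ 2 := by rw [hE, hF]
  have hq2 : 2 ≤ q ^ 2 := by rw [← hE]; exact Fintype.one_lt_card
  have hexp : (Nat.card K - 1) / (Nat.card E - 1) = M := by
    rw [Nat.card_eq_fintype_card, Nat.card_eq_fintype_card, hE, hM, Nat.add_sub_cancel]
    exact Nat.mul_div_cancel _ (by omega)
  have hMpos : M ≠ 0 := by
    rintro rfl
    have : 1 < Fintype.card K := Fintype.one_lt_card
    omega
  have htr : ∀ y : E, y ≠ 0 → (Algebra.trace F E y = 0 ↔ y ^ (q - 1) = -1) := by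
    intro y hy
    rw [← (algebraMap F E).injective.eq_iff, map_zero, algebraMap_trace_of_card_sq hE', hF]
    have : y + y ^ q = y * (1 + y ^ (q - 1)) := by
      rw [mul_add, mul_one, ← pow_succ', Nat.sub_add_cancel (by omega)]
    rw [this, mul_eq_zero, or_iff_right hy, add_comm, add_eq_zero_iff_eq_neg]
  rw [LinCode.definingSet, Set.mem_ofPred_eq, hexp]
  simp only [add_zero]
  constructor
  · rintro ⟨hx, y, hy, hty⟩
    have hy0 : y ≠ 0 := by
      rintro rfl
      rw [map_zero] at hy
      exact pow_ne_zero M hx hy.symm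
    rw [pow_mul, ← hy, ← map_pow, (htr y hy0).1 hty, map_neg, map_one]
  · intro h
    have hx : x ≠ 0 := by
      rintro rfl
      rw [zero_pow (Nat.mul_ne_zero hMpos (by omega))] at h
      exact neg_ne_zero.2 one_ne_zero h.symm
    have hfix : (x ^ M) ^ Fintype.card E = x ^ M := by
      have h1 := FiniteField.pow_card_sub_one_eq_one x hx
      rw [hM, Nat.add_sub_cancel] at h1
      calc (x ^ M) ^ Fintype.card E = x ^ (M * (q ^ 2 - 1)) * x ^ M := by
            rw [hE, ← pow_mul, ← pow_add]
            congr 1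
            rw [← Nat.mul_succ, Nat.succ_eq_add_one, Nat.sub_add_cancel (by omega)]
        _ = x ^ M := by rw [h1, one_mul]
    obtain ⟨y, hy⟩ := pow_card_eq_self_iff_mem_range.1 hfix
    have hy0 : y ≠ 0 := by
      rintro rfl
      rw [map_zero] at hy
      exact pow_ne_zero M hx hy.symm
    refine ⟨hx, y, hy, (htr y hy0).2 ?_⟩
    apply (algebraMap E K).injective
    rw [map_pow, hy, ← pow_mul, h, map_neg, map_one]

variable {α : Kˣ}

/-- The defining set is a coset of the group of `(q+1)`-th powers. -/
theorem exists_equiv_definingSet (hα : ∀ x : Kˣ, x ∈ Subgroup.zpowers α) (hF : Fintype.card F = q)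
    (hE : Fintype.card E = q ^ 2) (hM : Fintype.card K = M * (q ^ 2 - 1) + 1)
    {c : K} (hc : c ≠ 0) (hcM : c ^ (M * (q - 1)) = -1) :
    ∃ e : Fin (M * (q - 1)) ≃ LinCode.definingSet F E K 0,
      ∀ i, (e i : K) = c * (α : K) ^ ((q + 1) * (i : ℕ)) := by
  have hm : Fintype.card K - 1 = M * (q - 1) * (q + 1) := by
    rw [hM, Nat.add_sub_cancel, mul_sq_sub_one_eq]; ring
  have hK : 0 < Fintype.card K - 1 := Nat.sub_pos_of_lt Fintype.one_lt_card
  have hg : ((α : K) ^ (q + 1)) ^ (M * (q - 1)) = 1 := by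
    rw [← pow_mul, pow_eq_one_iff_card_sub_one_dvd hα, hm, mul_comm]
  have hmem : ∀ i : ℕ, c * (α : K) ^ ((q + 1) * i) ∈ LinCode.definingSet F E K 0 := by
    intro i
    rw [mem_definingSet_zero_iff hF hE hM, mul_pow, hcM, pow_mul (α : K),
      pow_right_comm _ i (M * (q - 1)), hg, one_pow, mul_one]
  refine ⟨Equiv.ofBijective (fun i => ⟨_, hmem i⟩) ⟨?_, ?_⟩, fun i => rfl⟩
  · intro i j hij
    have h1 := mul_left_cancel₀ hc (congrArg Subtype.val hij)
    have hlt : ∀ i : Fin (M * (q - 1)), (q + 1) * (i : ℕ) < Fintype.card K - 1 := fun i => by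
      rw [hm, mul_comm]
      exact Nat.mul_lt_mul_of_pos_right i.2 (Nat.succ_pos q)
    have := pow_injOn_range hα (by simpa using hlt i) (by simpa using hlt j) h1
    exact Fin.ext (Nat.eq_of_mul_eq_mul_left (Nat.succ_pos q) this)
  · rintro ⟨x, hx⟩
    rw [mem_definingSet_zero_iff hF hE hM] at hx
    obtain ⟨i, hi⟩ := exists_eq_pow_mul_of_pow_eq_one hα hm (x := x / c) (by
      rw [div_pow, hx, hcM, div_self (by simp)])
    have hpos : 0 < M * (q - 1) := Nat.pos_of_ne_zero fun h => by
      rw [hm, h] at hK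
      omega
    refine ⟨⟨i % (M * (q - 1)), Nat.mod_lt _ hpos⟩, Subtype.ext ?_⟩
    simp only
    rw [pow_mul, ← pow_eq_pow_mod _ hg, ← pow_mul, ← hi, mul_div_cancel₀ _ hc]

variable [Algebra F K]

theorem exists_pow_eq_neg_one (hα : ∀ x : Kˣ, x ∈ Subgroup.zpowers α) (hF : Fintype.card F = q)
    (hM : Fintype.card K = M * (q ^ 2 - 1) + 1) :
    ∃ c : K, c ≠ 0 ∧ c ^ (M * (q - 1)) = -1 := by
  have hneg : (-1 : K) ^ (q + 1) = 1 := by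
    have : (-1 : F) ^ q = -1 := by rw [← hF]; exact FiniteField.pow_card _
    have h2 : (-1 : F) ^ (q + 1) = 1 := by rw [pow_succ, this]; ring
    simpa using congrArg (algebraMap F K) h2
  obtain ⟨i, hi⟩ := exists_eq_pow_mul_of_pow_eq_one hα (s := q + 1) (t := M * (q - 1))
    (by rw [hM, Nat.add_sub_cancel, mul_sq_sub_one_eq]; ring) hneg
  exact ⟨(α : K) ^ i, by simp, by rw [hi, ← pow_mul, mul_comm]⟩

end Tower

/-! ### Trace codes and irreducibility -/

section TraceCode

variable {F K : Type*} [Field F] [Field K] [Algebra F K] {m : ℕ}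

theorem trace_pow_comp_finRotate {γ : K} (hγ : γ ^ m = 1) (x : K) :
    (fun i : Fin m => Algebra.trace F K (x * γ ^ (i : ℕ))) ∘ finRotate m =
      fun i : Fin m => Algebra.trace F K (γ * x * γ ^ (i : ℕ)) := by
  ext i
  have : NeZero m := ⟨fun h => by subst h; exact i.elim0⟩
  have h : γ ^ ((finRotate m i : Fin m) : ℕ) = γ ^ ((i : ℕ) + 1) := by
    rw [finRotate_apply, Fin.val_add, Fin.val_one', Nat.add_mod_mod, ← pow_eq_pow_mod _ hγ]
  simp only [Function.comp_apply, h]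
  congr 1
  ring

/-- Reordering the defining vector and scaling it by a nonzero constant permutes the coordinates
of a trace code. -/
theorem permEquivalent_traceCode {n : ℕ} {d : Fin n → K} {d' : Fin m → K} (e : Fin m ≃ Fin n)
    {c : K} (hc : c ≠ 0) (h : ∀ i, d (e i) = c * d' i) :
    LinCode.PermEquivalent (LinCode.traceCode F d) (LinCode.traceCode F d') := by
  refine ⟨e, fun v => ?_⟩
  rw [LinCode.mem_traceCode, LinCode.mem_traceCode]
  constructor
  · rintro ⟨x, rfl⟩
    refine ⟨x * c, ?_⟩
    ext i
    simp only [Function.comp_apply, h, mul_assoc]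
  · rintro ⟨x, hx⟩
    refine ⟨x / c, ?_⟩
    ext j
    obtain ⟨i, rfl⟩ := e.surjective j
    rw [h, ← mul_assoc, div_mul_cancel₀ _ hc]
    exact congrFun hx i

theorem hammingNorm_trace_mul [DecidableEq F] {n : ℕ} {d : Fin n → K} {d' : ℕ → K}
    (e : Fin m ≃ Fin n) {c : K} (h : ∀ i : Fin m, d (e i) = c * d' i) (x : K) :
    hammingNorm (fun i => Algebra.trace F K (x * d i)) =
      #{i ∈ range m | Algebra.trace F K (x * c * d' i) ≠ 0} := by
  rw [hammingNorm, card_filter, card_filter, ← Equiv.sum_comp e,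
    ← Fin.sum_univ_eq_sum_range (fun i => if Algebra.trace F K (x * c * d' i) ≠ 0 then 1 else 0)]
  simp only [h, mul_assoc]

end TraceCode

section Irreducible

variable {F K : Type*} [Field F] [Field K] [Fintype K] [Algebra F K] {α : Kˣ}
  {q m : ℕ}

/-- The element `α^(q+1)` has too large an order to lie in a proper subfield containing `F`. -/
theorem adjoin_pow_eq_top (hα : ∀ x : Kˣ, x ∈ Subgroup.zpowers α)
    (hm : Fintype.card K - 1 = m * (q + 1)) (hK : q ^ 2 < Fintype.card K) :
    Algebra.adjoin F {(α : K) ^ (q + 1)} = ⊤ := by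
  have : Algebra.IsAlgebraic F K := inferInstance
  rw [← IntermediateField.adjoin_simple_toSubalgebra_of_isAlgebraic
    (Algebra.IsAlgebraic.isAlgebraic _), ← IntermediateField.top_toSubalgebra]
  congr 1
  set L := IntermediateField.adjoin F {(α : K) ^ (q + 1)}
  by_contra hL
  have hr : Module.finrank L K ≠ 1 := fun h => hL (IntermediateField.finrank_eq_one_iff_eq_top.1 h)
  have hr0 : 0 < Module.finrank L K := Module.finrank_pos
  have hcard : Fintype.card K = Nat.card L ^ Module.finrank L K := by
    rw [← Nat.card_eq_fintype_card]
    exact Module.natCard_eq_pow_finrank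
  have hL1 : 1 < Nat.card L := Finite.one_lt_card
  have hsq : Nat.card L ^ 2 ≤ Fintype.card K := by
    rw [hcard]
    exact Nat.pow_le_pow_right (by omega) (by omega)
  have hpow : ((α : K) ^ (q + 1)) ^ (Nat.card L - 1) = 1 := by
    let g : L := ⟨(α : K) ^ (q + 1), IntermediateField.mem_adjoin_simple_self F _⟩
    have hg : g ≠ 0 := by
      intro h
      exact pow_ne_zero (q + 1) α.ne_zero (congrArg Subtype.val h)
    have : Fintype L := Fintype.ofFinite L
    have h := FiniteField.pow_card_sub_one_eq_one g hg
    rw [← Nat.card_eq_fintype_card] at h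
    exact congrArg Subtype.val h
  rw [← pow_mul, pow_eq_one_iff_card_sub_one_dvd hα, hm, mul_comm] at hpow
  have hmle : m ≤ Nat.card L - 1 :=
    Nat.le_of_dvd (by omega) (Nat.dvd_of_mul_dvd_mul_left (Nat.succ_pos q) hpow)
  obtain ⟨t, ht⟩ : ∃ t, Nat.card L = t + 1 := ⟨Nat.card L - 1, by omega⟩
  rw [ht] at hmle hsq hL1
  have h1 : Fintype.card K = m * (q + 1) + 1 := by omega
  have h2 : m * (q + 1) ≤ t * (q + 1) := Nat.mul_le_mul_right _ (by omega)
  have h3 : t + 1 ≤ q := by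
    by_contra h
    nlinarith
  nlinarith

/-- A cyclic subcode pulls back to a subspace of `K` stable under `F[γ] = K`. -/
theorem isIrreducibleCyclicCode_traceCode [Finite F] {γ : K} (hγ : γ ^ m = 1) (hm : m ≠ 0)
    (hadj : Algebra.adjoin F {γ} = ⊤) :
    LinCode.IsIrreducibleCyclicCode (LinCode.traceCode F fun i : Fin m => γ ^ (i : ℕ)) := by
  refine ⟨?_, ?_, ?_⟩
  · rintro _ ⟨x, rfl⟩
    exact ⟨γ * x, (trace_pow_comp_finRotate hγ x).symm⟩
  · intro h
    obtain ⟨x, hx⟩ := Algebra.trace_surjective F K 1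
    have hmem : (fun i : Fin m => Algebra.trace F K (x * γ ^ (i : ℕ))) ∈
        LinCode.traceCode F fun i : Fin m => γ ^ (i : ℕ) := ⟨x, rfl⟩
    rw [h, Submodule.mem_bot] at hmem
    have := congrFun hmem ⟨0, Nat.pos_of_ne_zero hm⟩
    simp [hx] at this
  · intro B hB hcyc
    set φ : K →ₗ[F] Fin m → F := LinearMap.pi fun i =>
      (Algebra.trace F K).comp (LinearMap.mulRight F (γ ^ (i : ℕ))) with hφ
    have hγB : ∀ x : K, φ x ∈ B → φ (γ * x) ∈ B := by
      intro x hx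
      have := hcyc _ hx
      rwa [show φ x ∘ finRotate m = φ (γ * x) from trace_pow_comp_finRotate hγ x] at this
    have hall : ∀ b x : K, φ x ∈ B → φ (b * x) ∈ B := by
      intro b
      have hb : b ∈ Algebra.adjoin F {γ} := hadj ▸ Algebra.mem_top
      induction hb using Algebra.adjoin_induction with
      | mem y hy =>
        rw [Set.mem_singleton_iff] at hy
        subst hy
        exact hγB
      | algebraMap r =>
        intro x hx
        rw [← Algebra.smul_def, map_smul]
        exact B.smul_mem r hx
      | add y z _ _ hy hz =>
        intro x hx
        rw [add_mul, map_add]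
        exact B.add_mem (hy x hx) (hz x hx)
      | mul y z _ _ hy hz =>
        intro x hx
        rw [mul_assoc]
        exact hy _ (hz x hx)
    by_cases h : ∃ x : K, x ≠ 0 ∧ φ x ∈ B
    · right
      obtain ⟨x, hx, hxB⟩ := h
      refine le_antisymm hB ?_
      rintro _ ⟨z, rfl⟩
      have := hall (z / x) x hxB
      rwa [div_mul_cancel₀ _ hx] at this
    · left
      rw [eq_bot_iff]
      intro c hcB
      obtain ⟨x, rfl⟩ := hB hcB
      by_cases hx : x = 0
      · rw [hx, map_zero]
        exact zero_mem _
      · exact absurd ⟨x, hx, hcB⟩ h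

end Irreducible

/-! ### The weight distribution -/

/-- Cancelling `q` in the weight formula, for an exponential sum of positive sign. -/
theorem mul_eq_of_weight_formula_pos {q w i j : ℕ} {S : ℤ} (hq : 2 ≤ q) (hij : j ≤ i)
    (hS : S = (q : ℤ) ^ (j + 1))
    (h : (q : ℤ) * ((q + 1) * w) = (q - 1) * (q ^ (i + 1) - S)) :
    (q + 1) * w = (q - 1) * (q ^ i - q ^ j) := by
  have hle : q ^ j ≤ q ^ i := Nat.pow_le_pow_right (by omega) hij
  have hq1 : 1 ≤ q := by omega
  zify [hle, hq1]
  apply mul_left_cancel₀ (show (q : ℤ) ≠ 0 by omega)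
  rw [h, hS]
  ring

/-- Cancelling `q` in the weight formula, for an exponential sum of negative sign. -/
theorem mul_eq_of_weight_formula_neg {q w i j : ℕ} {S : ℤ} (hq : 2 ≤ q)
    (hS : S = -(q : ℤ) ^ (j + 1))
    (h : (q : ℤ) * ((q + 1) * w) = (q - 1) * (q ^ (i + 1) - S)) :
    (q + 1) * w = (q - 1) * (q ^ i + q ^ j) := by
  have hq1 : 1 ≤ q := by omega
  zify [hq1]
  apply mul_left_cancel₀ (show (q : ℤ) ≠ 0 by omega)
  rw [h, hS]
  ring

theorem mul_pow_sub_pos_and_lt {q i j j' : ℕ} (hq : 2 ≤ q) (hij : j < i) :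
    0 < (q - 1) * (q ^ i - q ^ j) ∧
      (q - 1) * (q ^ i - q ^ j) < (q - 1) * (q ^ i + q ^ j') := by
  have h1 : q ^ j < q ^ i := Nat.pow_lt_pow_right (by omega) hij
  have h2 : 0 < q ^ j := Nat.pow_pos (by omega)
  exact ⟨Nat.mul_pos (by omega) (by omega), Nat.mul_lt_mul_of_pos_left (by omega) (by omega)⟩

theorem ncard_mul_right_eq {K : Type*} [Field K] {c : K} (hc : c ≠ 0) (P : K → Prop) :
    {x : K | x ≠ 0 ∧ P (x * c)}.ncard = {a : K | a ≠ 0 ∧ P a}.ncard := by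
  rw [← Set.ncard_image_of_injective _ (mul_left_injective₀ hc)]
  congr 1
  ext a
  constructor
  · rintro ⟨x, ⟨hx, hP⟩, rfl⟩
    exact ⟨mul_ne_zero hx hc, hP⟩
  · rintro ⟨ha, hP⟩
    exact ⟨a / c, ⟨div_ne_zero ha hc, by rwa [div_mul_cancel₀ _ hc]⟩, div_mul_cancel₀ _ hc⟩

/-- `F ⊆ E ⊆ K` are the fields with `q`, `q ^ 2` and `q ^ k` elements, `α` is a primitive element
of `K`, and `d` is an arbitrary ordering `d₁, …, dₙ` of the defining set. All the divisions by
`q + 1` below are exact and all the subtractions are of a smaller number from a larger one. -/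
theorem proposition1 {F E K : Type*} [Field F] [Field E] [Field K]
    [Finite F] [Finite E] [Finite K] [DecidableEq F]
    [Algebra F E] [Algebra E K] [Algebra F K] [IsScalarTower F E K]
    (q k : ℕ) (hF : Nat.card F = q) (hE : Nat.card E = q ^ 2) (hK : Nat.card K = q ^ k)
    (hk : 2 < k) (α : Kˣ) (hα : ∀ x : Kˣ, x ∈ Subgroup.zpowers α)
    (n : ℕ) (d : Fin n ≃ LinCode.definingSet F E K 0) :
    (LinCode.IsIrreducibleCyclicCode
        (LinCode.traceCode F
          (fun i : Fin ((q ^ k - 1) / (q + 1)) => (α : K) ^ ((q + 1) * (i : ℕ)))) ∧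
      LinCode.PermEquivalent
        (LinCode.traceCode F (fun i => (d i : K)))
        (LinCode.traceCode F
          (fun i : Fin ((q ^ k - 1) / (q + 1)) => (α : K) ^ ((q + 1) * (i : ℕ))))) ∧
    (k % 4 = 0 →
      n = (q ^ k - 1) / (q + 1) ∧
      LinCode.HasParameters (LinCode.traceCode F (fun i => (d i : K))) k
        ((q - 1) * (q ^ (k - 1) - q ^ (k / 2 - 1)) / (q + 1)) ∧
      LinCode.IsWeightCode 2 (LinCode.traceCode F (fun i => (d i : K))) ∧
      LinCode.weightEnumerator (LinCode.traceCode F (fun i => (d i : K))) =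
        1 + Polynomial.C (q * (q ^ k - 1) / (q + 1)) *
            Polynomial.X ^ ((q - 1) * (q ^ (k - 1) - q ^ (k / 2 - 1)) / (q + 1))
          + Polynomial.C ((q ^ k - 1) / (q + 1)) *
            Polynomial.X ^ ((q - 1) * (q ^ (k - 1) + q ^ (k / 2)) / (q + 1))) ∧
    (k % 4 = 2 →
      n = (q ^ k - 1) / (q + 1) ∧
      LinCode.HasParameters (LinCode.traceCode F (fun i => (d i : K))) k
        ((q - 1) * (q ^ (k - 1) - q ^ (k / 2)) / (q + 1)) ∧
      LinCode.IsWeightCode 2 (LinCode.traceCode F (fun i => (d i : K))) ∧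
      LinCode.weightEnumerator (LinCode.traceCode F (fun i => (d i : K))) =
        1 + Polynomial.C ((q ^ k - 1) / (q + 1)) *
            Polynomial.X ^ ((q - 1) * (q ^ (k - 1) - q ^ (k / 2)) / (q + 1))
          + Polynomial.C (q * (q ^ k - 1) / (q + 1)) *
            Polynomial.X ^ ((q - 1) * (q ^ (k - 1) + q ^ (k / 2 - 1)) / (q + 1))) := by
  have : Fintype F := Fintype.ofFinite F
  have : Fintype E := Fintype.ofFinite E
  have : Fintype K := Fintype.ofFinite K
  have hdim : k = Module.finrank F K := by
    have := Module.natCard_eq_pow_finrank (K := F) (V := K)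
    rw [hF, hK] at this
    exact Nat.pow_right_injective (hF ▸ Finite.one_lt_card) this
  rw [Nat.card_eq_fintype_card] at hF hE hK
  have hq : 2 ≤ q := by rw [← hF]; exact Fintype.one_lt_card
  -- The degree of `K` over `E` is the `l` with `k = 2 * l`.
  obtain ⟨l, hl⟩ : ∃ l, k = 2 * l := by
    refine ⟨Module.finrank E K, Nat.pow_right_injective hq ?_⟩
    have := Module.card_eq_pow_finrank (K := E) (V := K)
    rw [hK, hE, ← pow_mul] at this
    exact this
  obtain ⟨l, rfl⟩ : ∃ l', l = l' + 1 := ⟨l - 1, by omega⟩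
  have hl1 : 1 ≤ l := by omega
  have hqk : 1 ≤ q ^ k := Nat.one_le_pow _ _ (by omega)
  obtain ⟨M, hM⟩ : ∃ M, Fintype.card K = M * (q ^ 2 - 1) + 1 := by
    obtain ⟨M, hM⟩ := Nat.sub_dvd_pow_sub_pow (q ^ 2) 1 (l + 1)
    rw [one_pow, ← pow_mul, ← hl] at hM
    exact ⟨M, by rw [hK, mul_comm, ← hM]; omega⟩
  have hm : Fintype.card K - 1 = M * (q - 1) * (q + 1) := by
    rw [hM, Nat.add_sub_cancel, mul_sq_sub_one_eq]; ring
  have hm' : (q ^ k - 1) / (q + 1) = M * (q - 1) := by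
    rw [← hK, hm]; exact Nat.mul_div_cancel _ (by omega)
  have hlt : q ^ 2 < q ^ k := Nat.pow_lt_pow_right (by omega) hk
  have hm0 : M * (q - 1) ≠ 0 := fun h => by
    rw [h, zero_mul] at hm
    have : 0 < q ^ 2 := Nat.pow_pos (by omega)
    omega
  obtain ⟨c, hc, hcM⟩ := exists_pow_eq_neg_one hα hF hM
  obtain ⟨e₀, he₀⟩ := exists_equiv_definingSet (E := E) hα hF hE hM hc hcM
  let e : Fin (M * (q - 1)) ≃ Fin n := e₀.trans d.symm
  have he : ∀ i, (d (e i) : K) = c * (α : K) ^ ((q + 1) * (i : ℕ)) := fun i => by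
    rw [← he₀ i]; simp [e]
  have hn : n = M * (q - 1) := by simpa using (Fintype.card_congr e).symm
  have hK' : Fintype.card K = q ^ (2 * (l + 1)) := by rw [hK, hl]
  obtain ⟨hA, hB⟩ := card_isDegenerate E hα hF hE hM hK'
  rw [← ncard_mul_right_eq hc (IsDegenerate F), hK] at hA
  rw [← ncard_mul_right_eq hc (fun a => ¬ IsDegenerate F a), hK] at hB
  have hwt : ∀ x : K, x ≠ 0 → _ := fun x hx =>
    card_trace_ne_zero E hα hF hE hM hK' (mul_ne_zero hx hc)
  simp only [← hammingNorm_trace_mul (d := fun j => (d j : K))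
    (d' := fun i => (α : K) ^ ((q + 1) * i)) e he] at hwt
  have hb : q ^ k - 1 ≠ 0 := by
    have : 0 < q ^ 2 := Nat.pow_pos (by omega)
    omega
  have hqb : q * (q ^ k - 1) ≠ 0 := Nat.mul_ne_zero (by omega) hb
  have e1 : k - 1 = 2 * l + 1 := by omega
  have e2 : k / 2 - 1 = l := by omega
  have e3 : k / 2 = l + 1 := by omega
  have e4 : 2 * (l + 1) = 2 * l + 1 + 1 := by ring
  rw [e4] at hwt
  have hA' : {x : K | x ≠ 0 ∧ ¬ ¬ IsDegenerate F (x * c)}.ncard * (q + 1) = q ^ k - 1 := by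
    simpa only [not_not] using hA
  refine ⟨⟨?_, ?_⟩, ?_, ?_⟩
  · rw [hm']
    simp only [pow_mul (α : K)]
    refine isIrreducibleCyclicCode_traceCode ?_ hm0 (adjoin_pow_eq_top hα hm (by rwa [hK]))
    rw [← pow_mul, pow_eq_one_iff_card_sub_one_dvd hα, hm, mul_comm]
  · rw [hm']
    exact permEquivalent_traceCode e hc he
  · intro hk4
    have hev : Even (l + 1) := Nat.even_iff.2 (by omega)
    refine ⟨hn.trans hm'.symm, ?_⟩
    rw [e2, e1, e3]
    nth_rewrite 1 [hdim]
    obtain ⟨h0, h12⟩ := mul_pow_sub_pos_and_lt (j := l) (j' := l + 1) hq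
      (show l < 2 * l + 1 by omega)
    refine hasParameters_and_weightEnumerator_of_two_weights_div _
      (fun x => ¬ IsDegenerate F (x * c)) (Nat.succ_pos q) h0 h12 ?_ ?_ hqb hb hB hA'
    · intro x hx hP
      exact mul_eq_of_weight_formula_pos hq (by omega) (hev.neg_pow _) ((hwt x hx).2 hP)
    · intro x hx hP
      exact mul_eq_of_weight_formula_neg hq (hev.add_one.neg_pow _) ((hwt x hx).1 (not_not.1 hP))
  · intro hk4
    have hodd : Odd (l + 1) := Nat.odd_iff.2 (by omega)
    refine ⟨hn.trans hm'.symm, ?_⟩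
    rw [e2, e1, e3]
    nth_rewrite 1 [hdim]
    obtain ⟨h0, h12⟩ := mul_pow_sub_pos_and_lt (j := l + 1) (j' := l) hq
      (show l + 1 < 2 * l + 1 by omega)
    refine hasParameters_and_weightEnumerator_of_two_weights_div _
      (fun x => IsDegenerate F (x * c)) (Nat.succ_pos q) h0 h12 ?_ ?_ hb hqb hA hB
    · intro x hx hP
      exact mul_eq_of_weight_formula_pos hq (by omega) (hodd.add_one.neg_pow _) ((hwt x hx).1 hP)
    · intro x hx hP
      exact mul_eq_of_weight_formula_neg hq (hodd.neg_pow _) ((hwt x hx).2 hP)
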